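/- **Setting.** A feed-forward network of depth $\ell$ and width $w$ has an input layer $0$, hidden layers $1,\dots,\ell-1$ with at most $w$ neurons each, and an output layer $\ell$. Each neuron outside the input layer applies an activation function to a weighted sum of the outputs of the previous layer ($\sigma$ at hidden neurons, $\sigma_{\rm out}$ at output neurons; both are arbitrary measurable functions $\mathbb R\to\mathbb R$), and the weights entering each neuron have $1$-norm at most $M\ge 0$. The class of these networks is $\Theta^{\ell,w}_M$. A RUMnet architecture $N\in{\cal N}^{\boldsymbol d}(K,\Theta^{\ell,w}_M)$, $K\ge 1$, consists of networks $N_U:\mathbb R^{d_x+d_\epsilon+d_z+d_\nu}\to\mathbb R$, $N_{\epsilon_1},\dots,N_{\epsilon_K}:\mathbb R^{d_x}\to\mathbb R^{d_\epsilon}$ and $N_{\nu_1},\dots,N_{\nu_K}:\mathbb R^{d_z}\to\mathbb R^{d_\nu}$ in $\Theta^{\ell,w}_M$. For a customer with attributes $z$, a finite assortment $A\subset\mathbb R^{d_x}$ and $x\in A$, its choice probabilities are $$\pi_N(x,z,A)=\frac1{K^2}\sum_{k_1,k_2=1}^K \Pr_{\boldsymbol\delta}\Big[N_U\big(x,N_{\epsilon_{k_1}}(x),z,N_{\nu_{k_2}}(z)\big)+\delta_x>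 N_U\big(x',N_{\epsilon_{k_1}}(x'),z,N_{\nu_{k_2}}(z)\big)+\delta_{x'}\ \ \forall x'\in A\setminus\{x\}\Big],$$ where $(\delta_x)_{x\in A}$ are i.i.d. with a law that has a strictly positive density on $\mathbb R$. Let ${\cal D}$ be a probability distribution of choice events $(z,A)$ with $z\in{\cal Z}$ and $A\subseteq{\cal X}$ finite, $1\le|A|\le\kappa$, where ${\cal X}\subseteq\mathbb R^{d_x}$ and ${\cal Z}\subseteq\mathbb R^{d_z}$ are compact. For distributions $P,Q$ on $A$ write ${\sf KL}(P\,\|\,Q)=\sum_{y\in A}P(y)\log\frac{P(y)}{Q(y)}$. **Proposition 4.** There are absolute constants $c_1,c_2>0$ such that the following holds in this setting, for all $0<\epsilon\le 1$, all $0<\delta\le\frac12$ and every $N\in{\cal N}^{\boldsymbol d}(K,\Theta^{\ell,w}_M)$. Let $$K'\ \ge\ \left\lceil \frac{1}{2\epsilon^2}\,\log\frac1\delta\,(\kappa e^{2M})^2\,\log\left\lceil\frac{16}{\max\{c_1^2,c_2^2\}\,\epsilon^2}\,\kappa^3e^{4M}\max\{1,M\}^{2\ell}\right\rceil\right\rceil$$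 (equality gives $K'=O\big(\epsilon^{-2}\,{\rm poly}(\log\frac1\epsilon,\ell,\kappa,e^M)\log\frac1\delta\big)$), and let $N'\in{\cal N}^{\boldsymbol d}(K',\Theta^{\ell,w}_M)$ be the random architecture that has the same $N_U$ as $N$ and whose $K'$ unobserved product networks and $K'$ unobserved customer networks are drawn independently and uniformly with replacement from $\{N_{\epsilon_k}\}_{k=1}^K$ and from $\{N_{\nu_k}\}_{k=1}^K$. Then: 1. With probability at least $1-\delta$, $$\mathbb E_{(z,A)\sim{\cal D}}\big[{\sf KL}\big(\pi_{N'}(\cdot,z,A)\,\|\,\pi_N(\cdot,z,A)\big)\big]\le 3\epsilon .$$ 2. Suppose in addition that the law of $\delta_x$ is the standard Gumbel law (so that the choice probabilities are averages of softmax probabilities), that $\ell\ge2$, that $|\sigma(t)|\le1$ and that $|\sigma_{\rm out}(t)|\le\max\{1,|t|\}$ for all $t\in\mathbb R$. Then also, with probability at least $1-\delta$, $$\mathbb E_{(z,A)\sim{\cal D}}\big[{\sf KL}\big(\pi_{N}(\cdot,z,A)\,\|\,\pi_{N'}(\cdot,z,A)\big)\big]\le 3\epsilon .$$ -/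

import Mathlib

open MeasureTheory

noncomputable section

namespace RUMnet

/-- A feed-forward neural network with `ℓ` layers of edges (depth `ℓ`), from `ℝ^m` to `ℝ^n`.
Layer `t` has `size t` neurons; hidden layers have at most `w` neurons; a missing edge is an edge
of weight `0`.  The weights entering each neuron have `1`-norm at most `M`. -/
structure FeedForwardNet (ℓ w : ℕ) (M : ℝ) (m n : ℕ) where
  size : ℕ → ℕ
  size_input : size 0 = m
  size_output : size ℓ = n
  size_hidden : ∀ t, 0 < t → t < ℓ → size t ≤ w
  weight : ∀ t, Fin (size (t + 1)) → Fin (size t) → ℝ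
  norm_weight : ∀ t < ℓ, ∀ i, ∑ j, |weight t i j| ≤ M

namespace FeedForwardNet

variable {ℓ w : ℕ} {M : ℝ} {m n : ℕ}

/-- Outputs of the neurons of layer `t` on input `x`.  The neurons of the output layer `ℓ` have
activation function `σout`, those of the hidden layers have activation function `σ`. -/
def layerOutput (f : FeedForwardNet ℓ w M m n) (σ σout : ℝ → ℝ) (x : Fin m → ℝ) :
    (t : ℕ) → Fin (f.size t) → ℝ
  | 0 => fun i => x (Fin.cast f.size_input i)
  | t + 1 => fun i =>
      (if t + 1 = ℓ then σout else σ) (∑ j, f.weight t i j * f.layerOutput σ σout x t j)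

/-- The function `ℝ^m → ℝ^n` computed by the network. -/
def eval (f : FeedForwardNet ℓ w M m n) (σ σout : ℝ → ℝ) (x : Fin m → ℝ) : Fin n → ℝ :=
  fun i => f.layerOutput σ σout x ℓ (Fin.cast f.size_output.symm i)

end FeedForwardNet

/-- The RUMnet architectures with `K` samples of the unobserved product attributes and `K` samples
of the unobserved customer attributes. -/
structure Architecture (dx dε dz dν K ℓ w : ℕ) (M : ℝ) where
  utility : FeedForwardNet ℓ w M (dx + dε + dz + dν) 1
  product : Fin K → FeedForwardNet ℓ w M dx dε
  customer : Fin K → FeedForwardNet ℓ w M dz dν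

/-- A choice event: a customer with observable attributes `z` is offered the finite assortment `A`
of alternatives, each given by its observable attributes. -/
structure ChoiceEvent (dx dz : ℕ) where
  z : Fin dz → ℝ
  A : Finset (Fin dx → ℝ)

/-- The usual σ-algebra on choice events: Borel in the customer attributes, and generated by the
counts `#(A ∩ B)`, `B` Borel, in the assortment (the σ-algebra of finite point configurations). -/
instance (dx dz : ℕ) : MeasurableSpace (ChoiceEvent dx dz) :=
  MeasurableSpace.comap ChoiceEvent.z inferInstance ⊔
    ⨆ B : {B : Set (Fin dx → ℝ) // MeasurableSet B},
      MeasurableSpace.comap (fun e => ((e.A : Set (Fin dx → ℝ)) ∩ B.1).ncard) ⊤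

/-- The noise law has a strictly positive density on `ℝ`. -/
def HasPositiveDensity (μ : Measure ℝ) : Prop :=
  ∃ f : ℝ → ℝ, Measurable f ∧ (∀ t, 0 < f t) ∧
    μ = volume.withDensity (fun t => ENNReal.ofReal (f t))

/-- The standard Gumbel distribution. -/
def gumbel : Measure ℝ :=
  volume.withDensity (fun t => ENNReal.ofReal (Real.exp (-(t + Real.exp (-t)))))

namespace Architecture

variable {dx dε dz dν K ℓ w : ℕ} {M : ℝ}

/-- The deterministic utility `N_U(x, N_{ε_{k₁}}(x), z, N_{ν_{k₂}}(z))`. -/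
def sampleUtility (N : Architecture dx dε dz dν K ℓ w M) (σ σout : ℝ → ℝ) (k₁ k₂ : Fin K)
    (x : Fin dx → ℝ) (z : Fin dz → ℝ) : ℝ :=
  N.utility.eval σ σout
    (Fin.append (Fin.append (Fin.append x ((N.product k₁).eval σ σout x)) z)
      ((N.customer k₂).eval σ σout z)) 0

/-- The probability that the customer chooses `x` in the choice event `e`, where the shocks
`δ = (δ_x)_{x ∈ A}` are independent with common law `μ`. -/
def choiceProb (N : Architecture dx dε dz dν K ℓ w M) (σ σout : ℝ → ℝ) (μ : Measure ℝ)
    (e : ChoiceEvent dx dz) (x : e.A) : ℝ :=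
  1 / (K : ℝ) ^ 2 * ∑ k₁ : Fin K, ∑ k₂ : Fin K,
    (Measure.pi fun _ : e.A => μ).real
      {δ | ∀ x' : e.A, x' ≠ x →
        N.sampleUtility σ σout k₁ k₂ x' e.z + δ x' < N.sampleUtility σ σout k₁ k₂ x e.z + δ x}

/-- The choice distribution on the assortment, as a measure. -/
def choiceDist (N : Architecture dx dε dz dν K ℓ w M) (σ σout : ℝ → ℝ) (μ : Measure ℝ)
    (e : ChoiceEvent dx dz) : Measure e.A :=
  ∑ x : e.A, ENNReal.ofReal (N.choiceProb σ σout μ e x) • Measure.dirac x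

/-- The architecture whose samples of unobserved attributes are those of `N` with the indices
`s.1 1, …, s.1 K'` (products) and `s.2 1, …, s.2 K'` (customers). -/
def resample (N : Architecture dx dε dz dν K ℓ w M) {K' : ℕ}
    (s : (Fin K' → Fin K) × (Fin K' → Fin K)) : Architecture dx dε dz dν K' ℓ w M where
  utility := N.utility
  product := fun i => N.product (s.1 i)
  customer := fun i => N.customer (s.2 i)

end Architecture

/-- The expected KL divergence `E_{(z,A) ∼ D} KL(π_{N₁}(·,z,A) ‖ π_{N₂}(·,z,A))`. -/
def expectedKL {dx dε dz dν K₁ K₂ ℓ w : ℕ} {M : ℝ} (σ σout : ℝ → ℝ) (μ : Measure ℝ)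
    (D : Measure (ChoiceEvent dx dz)) (N₁ : Architecture dx dε dz dν K₁ ℓ w M)
    (N₂ : Architecture dx dε dz dν K₂ ℓ w M) : ENNReal :=
  ∫⁻ e, InformationTheory.klDiv (N₁.choiceDist σ σout μ e) (N₂.choiceDist σ σout μ e) ∂D

/-- The number `K'` of samples, for given constants `c₁`, `c₂`. -/
def numSamples (c₁ c₂ : ℝ) (κ ℓ : ℕ) (M ε δ : ℝ) : ℕ :=
  ⌈1 / (2 * ε ^ 2) * Real.log (1 / δ) * ((κ : ℝ) * Real.exp (2 * M)) ^ 2 *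
    Real.log (⌈16 / (max (c₁ ^ 2) (c₂ ^ 2) * ε ^ 2) * (κ : ℝ) ^ 3 * Real.exp (4 * M) *
      (max 1 M) ^ (2 * ℓ)⌉₊ : ℝ)⌉₊

end RUMnet

end

/-! Fix a choice event and an alternative `y`. Let `q` be its probability under `N` and `p` its
probability under the resampled architecture. Then `p` is a double average, over `n = K'` product
draws and `n` customer draws, of numbers in `[0,1]` with mean `q`, and the divergence is the sum
over `y` of `q * klFun (p / q)`. Everything rests on an exponential moment of this quantity.

For the mean of `n` independent draws, the Chernoff bound has rate exactly `n * q * klFun (p / q)`,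
so half of this rate has exponential moment at most 10, uniformly in `q`; no lower bound on `q` is
needed. A double average is an average of such means over cyclic shifts, and convexity transfers the
moment to it (`sum_exp_klFun_double_mean_le`). Jensen over at most `κ` alternatives divides the
exponent by `κ` (`sum_exp_sum_klFun_le`), and Jensen over `D` followed by Markov bounds the failure
probability by `10 * exp (-n τ / (2κ))` (`le_uniformOn_lintegral_le`).

For the reverse divergence, Gumbel shocks and bounded utilities keep all choice probabilities above
`1 / (64 κ e^{2M})`. The two divergences then differ by a factor of at most `256 κ e^{2M}`, so the
forward bound is proved at a level `τ` smaller than `ε` by a comparable factor. -/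

open InformationTheory (klFun klFun_nonneg klFun_apply convexOn_klFun)

/-! ### Exponential moments of the relative entropy of empirical means. -/

section Concentration

variable {Ω W : Type*} [Fintype Ω] [Fintype W]

/-- The exponential moments of a sum of independent `[0,1]`-valued variables are at most those of
a Poisson variable with the same mean. -/
lemma sum_rpow_sum_le [Nonempty W] (a : W → ℝ) (ha0 : ∀ w, 0 ≤ a w) (ha1 : ∀ w, a w ≤ 1) (n : ℕ)
    {x : ℝ} (hx : 0 ≤ x) :
    ∑ ω : Fin n → W, x ^ (∑ i, a (ω i)) ≤
      (Fintype.card W : ℝ) ^ n *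
        Real.exp (n * ((∑ w, a w) / Fintype.card W) * (x - 1)) := by
  have hW : (0 : ℝ) < Fintype.card W := by exact_mod_cast Fintype.card_pos
  have h1 : ∑ ω : Fin n → W, x ^ (∑ i, a (ω i)) = (∑ w, x ^ a w) ^ n := by
    rw [Fintype.sum_pow]
    exact Finset.sum_congr rfl fun ω _ => Real.rpow_sum_of_nonneg hx fun i _ => ha0 _
  have h2 : ∑ w, x ^ a w ≤
      Fintype.card W * Real.exp ((∑ w, a w) / Fintype.card W * (x - 1)) := by
    calc ∑ w, x ^ a w ≤ ∑ w, (1 + a w * (x - 1)) := by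
          refine Finset.sum_le_sum fun w _ => ?_
          have := rpow_one_add_le_one_add_mul_self (s := x - 1) (by linarith) (ha0 w) (ha1 w)
          simpa using this
      _ = Fintype.card W * ((∑ w, a w) / Fintype.card W * (x - 1) + 1) := by
          rw [Finset.sum_add_distrib, ← Finset.sum_mul]
          simp only [Finset.sum_const, Finset.card_univ, nsmul_eq_mul, mul_one]
          field_simp
          ring
      _ ≤ _ := by gcongr; exact Real.add_one_le_exp _
  rw [h1]
  refine (pow_le_pow_left₀ (Finset.sum_nonneg fun w _ => Real.rpow_nonneg hx _) h2 n).trans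
    (le_of_eq ?_)
  rw [mul_pow, ← Real.exp_nat_mul]
  ring_nf

/-- Identifies the Chernoff exponent: for a Poisson variable of mean `m` and threshold `m * u`, the
optimal base is `u` itself. -/
lemma rpow_mul_exp_eq_exp_klFun {m u : ℝ} (hu : 0 ≤ u) :
    u ^ (m * u) * Real.exp (-(m * (u - 1))) = Real.exp (m * klFun u) := by
  rcases hu.eq_or_lt with rfl | hu
  · simp [InformationTheory.klFun_zero]
  · rw [Real.rpow_def_of_pos hu, ← Real.exp_add, klFun_apply]
    ring_nf

/-- Chernoff bound in terms of the relative entropy, one tail: `u` is an extreme point of the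
event `T`. -/
lemma card_mul_exp_klFun_le (S : Ω → ℝ) {m c : ℝ} (hm : 0 < m)
    (h : ∀ x : ℝ, 0 ≤ x → ∑ ω, x ^ S ω ≤ c * Real.exp (m * (x - 1)))
    (T : Finset Ω) {ω₀ : Ω} (h0 : 0 ≤ S ω₀)
    (hT : ∀ ω ∈ T, (S ω₀ / m) ^ S ω₀ ≤ (S ω₀ / m) ^ S ω) :
    (T.card : ℝ) * Real.exp (m * klFun (S ω₀ / m)) ≤ c := by
  set u := S ω₀ / m with hu
  have hu0 : 0 ≤ u := by positivity
  have hmu : m * u = S ω₀ := by rw [hu]; field_simp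
  have h1 : (T.card : ℝ) * u ^ S ω₀ ≤ c * Real.exp (m * (u - 1)) :=
    calc (T.card : ℝ) * u ^ S ω₀ = ∑ ω ∈ T, u ^ S ω₀ := by simp
      _ ≤ ∑ ω ∈ T, u ^ S ω := Finset.sum_le_sum hT
      _ ≤ ∑ ω, u ^ S ω :=
          Finset.sum_le_sum_of_subset_of_nonneg (Finset.subset_univ _)
            fun _ _ _ => Real.rpow_nonneg hu0 _
      _ ≤ _ := h u hu0
  rw [← rpow_mul_exp_eq_exp_klFun hu0, hmu, ← mul_assoc]
  calc (T.card : ℝ) * u ^ S ω₀ * Real.exp (-(m * (u - 1)))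
      ≤ c * Real.exp (m * (u - 1)) * Real.exp (-(m * (u - 1))) := by gcongr
    _ = c := by rw [mul_assoc, ← Real.exp_add]; simp

open Classical in
/-- Two-sided Chernoff bound in terms of the relative entropy. -/
lemma card_filter_klFun_le (S : Ω → ℝ) (hS : ∀ ω, 0 ≤ S ω) {m c : ℝ} (hm : 0 < m) (hc : 0 ≤ c)
    (h : ∀ x : ℝ, 0 ≤ x → ∑ ω, x ^ S ω ≤ c * Real.exp (m * (x - 1))) (t : ℝ) :
    ((Finset.univ.filter fun ω => t ≤ m * klFun (S ω / m)).card : ℝ) ≤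
      2 * c * Real.exp (-t) := by
  have key : ∀ T : Finset Ω, (∀ ω ∈ T, t ≤ m * klFun (S ω / m)) →
      (T.Nonempty → ∃ ω₀ ∈ T, ∀ ω ∈ T, (S ω₀ / m) ^ S ω₀ ≤ (S ω₀ / m) ^ S ω) →
      (T.card : ℝ) ≤ c * Real.exp (-t) := by
    intro T hT hex
    rcases T.eq_empty_or_nonempty with rfl | hne
    · simp; positivity
    obtain ⟨ω₀, h0, hmin⟩ := hex hne
    have := card_mul_exp_klFun_le S hm h T (hS ω₀) hmin
    have h2 : (T.card : ℝ) * Real.exp t ≤ c :=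
      le_trans (by gcongr; exact hT ω₀ h0) this
    rw [Real.exp_neg, ← div_eq_mul_inv, le_div_iff₀ (Real.exp_pos t)]
    exact h2
  set F := Finset.univ.filter fun ω => t ≤ m * klFun (S ω / m) with hF
  have hF' : ∀ ω ∈ F, t ≤ m * klFun (S ω / m) := fun ω hω => (Finset.mem_filter.1 hω).2
  have hsplit := Finset.card_filter_add_card_filter_not (s := F) (fun ω => m ≤ S ω)
  have hup := key (F.filter fun ω => m ≤ S ω)
    (fun ω hω => hF' ω (Finset.mem_filter.1 hω).1) (by
      intro hne
      obtain ⟨ω₀, h0, hmin⟩ := Finset.exists_min_image _ S hne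
      refine ⟨ω₀, h0, fun ω hω => ?_⟩
      refine Real.rpow_le_rpow_of_exponent_le ?_ (hmin ω hω)
      rw [le_div_iff₀ hm, one_mul]
      exact (Finset.mem_filter.1 h0).2)
  have hlow := key (F.filter fun ω => ¬ m ≤ S ω)
    (fun ω hω => hF' ω (Finset.mem_filter.1 hω).1) (by
      intro hne
      obtain ⟨ω₀, h0, hmax⟩ := Finset.exists_max_image _ S hne
      refine ⟨ω₀, h0, fun ω hω => ?_⟩
      have hle : S ω₀ / m ≤ 1 := by
        rw [div_le_one hm]
        exact (not_le.1 (Finset.mem_filter.1 h0).2).le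
      -- At base `0` the power is not antitone in the exponent, but then `S` vanishes on the whole
      -- lower tail.
      rcases (hS ω₀).eq_or_lt with hz | hpos
      · have : S ω = 0 := le_antisymm (hz ▸ hmax ω hω) (hS ω)
        rw [this, ← hz]
      · exact Real.rpow_le_rpow_of_exponent_ge (by positivity) hle (hmax ω hω))
  have : (F.card : ℝ) = (F.filter fun ω => m ≤ S ω).card + (F.filter fun ω => ¬ m ≤ S ω).card := by
    exact_mod_cast hsplit.symm
  rw [this]
  linarith

open Classical in
/-- Layer-cake bound: an exponential tail gives an exponential moment. -/
lemma sum_exp_half_le (Z : Ω → ℝ) (hZ : ∀ ω, 0 ≤ Z ω) {c : ℝ} (hc : 0 ≤ c)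
    (h : ∀ t : ℝ, ((Finset.univ.filter fun ω => t ≤ Z ω).card : ℝ) ≤ 2 * c * Real.exp (-t)) :
    ∑ ω, Real.exp (Z ω / 2) ≤ 10 * c := by
  set r := Real.exp (-(1 / 2)) with hr
  have hr0 : 0 < r := Real.exp_pos _
  have hr2 : r * r < 0.37 := by
    rw [hr, ← Real.exp_add]
    norm_num
    exact lt_trans Real.exp_neg_one_lt_d9 (by norm_num)
  -- The layers sum to a geometric series of ratio `r`; for `r` in `[0.5, 0.7]` one has `r * (1 - r)
  -- ≥ 1/5`, hence the factor 5 below.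
  have hrl : 1 / 2 ≤ r := by
    have := Real.add_one_le_exp (-(1 / 2 : ℝ))
    linarith
  have hru : r ≤ 0.7 := by nlinarith
  set J := Finset.univ.sup fun ω => ⌊Z ω⌋₊ with hJ
  have h1 : ∀ ω, Real.exp (Z ω / 2) ≤
      ∑ j ∈ Finset.range (J + 1), if (j : ℝ) ≤ Z ω then Real.exp (((j : ℝ) + 1) / 2) else 0 := by
    intro ω
    have hmem : ⌊Z ω⌋₊ ∈ Finset.range (J + 1) :=
      Finset.mem_range_succ_iff.2 (Finset.le_sup (f := fun ω => ⌊Z ω⌋₊) (Finset.mem_univ ω))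
    refine le_trans ?_ (Finset.single_le_sum
      (f := fun j : ℕ => if (j : ℝ) ≤ Z ω then Real.exp (((j : ℝ) + 1) / 2) else 0)
      (fun j _ => by positivity) hmem)
    simp only [Nat.floor_le (hZ ω), if_true]
    have := (Nat.lt_floor_add_one (Z ω)).le
    gcongr
  calc ∑ ω, Real.exp (Z ω / 2)
      ≤ ∑ ω, ∑ j ∈ Finset.range (J + 1),
          (if (j : ℝ) ≤ Z ω then Real.exp (((j : ℝ) + 1) / 2) else 0) :=
        Finset.sum_le_sum fun ω _ => h1 ω
    _ = ∑ j ∈ Finset.range (J + 1),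
          ((Finset.univ.filter fun ω => (j : ℝ) ≤ Z ω).card : ℝ) *
            Real.exp (((j : ℝ) + 1) / 2) := by
        rw [Finset.sum_comm]
        refine Finset.sum_congr rfl fun j _ => ?_
        rw [← Finset.sum_filter]
        simp
    _ ≤ ∑ j ∈ Finset.range (J + 1), 2 * c * r⁻¹ * r ^ j := by
        refine Finset.sum_le_sum fun j _ => ?_
        calc _ ≤ 2 * c * Real.exp (-(j : ℝ)) * Real.exp (((j : ℝ) + 1) / 2) := by
              gcongr; exact h j
          _ = _ := by
              rw [hr, ← Real.exp_neg, ← Real.exp_nat_mul, mul_assoc, mul_assoc _ _ (Real.exp _),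
                ← Real.exp_add, ← Real.exp_add]
              ring_nf
    _ = 2 * c * r⁻¹ * ∑ j ∈ Finset.range (J + 1), r ^ j := by rw [Finset.mul_sum]
    _ ≤ 2 * c * r⁻¹ * (1 - r)⁻¹ := by
        gcongr
        exact (summable_geometric_of_lt_one hr0.le (by linarith)).sum_le_tsum _
          (fun j _ => by positivity) |>.trans_eq
            (tsum_geometric_of_lt_one hr0.le (by linarith))
    _ ≤ 2 * c * 5 := by
        rw [mul_assoc, ← mul_inv]
        gcongr
        rw [inv_le_comm₀ (mul_pos hr0 (by linarith)) (by norm_num)]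
        nlinarith [mul_nonneg (sub_nonneg.2 hrl) (sub_nonneg.2 hru)]
    _ = 10 * c := by ring

/-- Exponential moment of the relative entropy of an empirical mean. -/
lemma sum_exp_klFun_mean_le [Nonempty W] (a : W → ℝ) (ha0 : ∀ w, 0 ≤ a w) (ha1 : ∀ w, a w ≤ 1)
    (n : ℕ) (hn : 0 < n) {q : ℝ} (hq : q = (∑ w, a w) / Fintype.card W) :
    ∑ ω : Fin n → W, Real.exp (n / 2 * (q * klFun ((∑ i, a (ω i)) / n / q))) ≤
      10 * (Fintype.card W : ℝ) ^ n := by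
  classical
  have hn' : (0 : ℝ) < n := by exact_mod_cast hn
  have hq0 : 0 ≤ q := by rw [hq]; exact div_nonneg (Finset.sum_nonneg fun w _ => ha0 w) (by simp)
  rcases hq0.eq_or_lt with hz | hqpos
  · simp only [← hz, zero_mul, mul_zero, Real.exp_zero, Finset.sum_const, Finset.card_univ,
      nsmul_eq_mul, mul_one, Fintype.card_fun, Fintype.card_fin, Nat.cast_pow]
    nlinarith [pow_nonneg (Nat.cast_nonneg (α := ℝ) (Fintype.card W)) n]
  have hS : ∀ ω : Fin n → W, 0 ≤ ∑ i, a (ω i) := fun ω => Finset.sum_nonneg fun i _ => ha0 _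
  have hm : 0 < n * q := by positivity
  have := sum_exp_half_le (fun ω : Fin n → W => n * q * klFun ((∑ i, a (ω i)) / (n * q)))
    (fun ω => mul_nonneg hm.le (klFun_nonneg (div_nonneg (hS ω) hm.le)))
    (c := (Fintype.card W : ℝ) ^ n) (by positivity)
    (card_filter_klFun_le _ hS hm (by positivity)
      fun x hx => by simpa only [hq] using sum_rpow_sum_le a ha0 ha1 n hx)
  refine le_trans (le_of_eq ?_) this
  refine Finset.sum_congr rfl fun ω _ => ?_
  rw [div_div]
  ring_nf

/-- An increasing convex function of a convex function. This is what allows Jensen over cyclic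
shifts; `q = 0` is harmless because the exponent is then zero. -/
lemma convexOn_exp_klFun {q θ : ℝ} (hq : 0 ≤ q) (hθ : 0 ≤ θ) :
    ConvexOn ℝ (Set.Ici 0) fun p : ℝ => Real.exp (θ * (q * klFun (p / q))) := by
  refine ⟨convex_Ici 0, fun x hx y hy a b ha hb hab => ?_⟩
  have hx' : x / q ∈ Set.Ici (0 : ℝ) := div_nonneg hx hq
  have hy' : y / q ∈ Set.Ici (0 : ℝ) := div_nonneg hy hq
  have h1 := convexOn_klFun.2 hx' hy' ha hb hab
  have h2 : (a • x + b • y) / q = a • (x / q) + b • (y / q) := by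
    simp only [smul_eq_mul]; ring
  refine le_trans ?_ (convexOn_exp.2 (Set.mem_univ _) (Set.mem_univ _) ha hb hab)
  refine Real.exp_le_exp.2 ?_
  rw [h2]
  calc _ ≤ θ * (q * (a • klFun (x / q) + b • klFun (y / q))) := by gcongr
    _ = _ := by simp only [smul_eq_mul]; ring

/-- Exponential moment of the relative entropy of a two-sample mean: the double average over
`i, j` is the average over the cyclic shifts `r` of the means of `a (s i, t (i + r))`. -/
lemma sum_exp_klFun_double_mean_le {V : Type*} [Fintype V] [Nonempty V] [Nonempty W]
    (a : W → V → ℝ) (ha0 : ∀ w v, 0 ≤ a w v) (ha1 : ∀ w v, a w v ≤ 1) (n : ℕ) (hn : 0 < n) {q : ℝ}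
    (hq : q = (∑ w, ∑ v, a w v) / (Fintype.card W * Fintype.card V)) :
    ∑ s : (Fin n → W) × (Fin n → V),
        Real.exp (n / 2 * (q * klFun (1 / (n : ℝ) ^ 2 * (∑ i, ∑ j, a (s.1 i) (s.2 j)) / q))) ≤
      10 * Fintype.card ((Fin n → W) × (Fin n → V)) := by
  have : NeZero n := ⟨hn.ne'⟩
  have hn' : (0 : ℝ) < n := by exact_mod_cast hn
  have hq0 : 0 ≤ q := by
    rw [hq]
    exact div_nonneg (Finset.sum_nonneg fun w _ => Finset.sum_nonneg fun v _ => ha0 w v)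
      (by positivity)
  set φ : ℝ → ℝ := fun p => Real.exp (n / 2 * (q * klFun (p / q))) with hφ
  have hconv : ConvexOn ℝ (Set.Ici 0) φ := convexOn_exp_klFun hq0 (by positivity)
  have hshift : ∀ s : (Fin n → W) × (Fin n → V),
      1 / (n : ℝ) ^ 2 * (∑ i, ∑ j, a (s.1 i) (s.2 j)) =
        ∑ r : Fin n, (1 / (n : ℝ)) • ((∑ i, a (s.1 i) (s.2 (i + r))) / n) := by
    intro s
    have : ∑ i, ∑ j, a (s.1 i) (s.2 j) = ∑ r : Fin n, ∑ i, a (s.1 i) (s.2 (i + r)) := by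
      rw [Finset.sum_comm (f := fun r i => a (s.1 i) (s.2 (i + r)))]
      refine Finset.sum_congr rfl fun i _ => ?_
      exact (Equiv.sum_comp (Equiv.addLeft i) fun j => a (s.1 i) (s.2 j)).symm
    rw [this, ← Finset.smul_sum, ← Finset.sum_div, smul_eq_mul]
    field_simp
  have hjensen : ∀ s : (Fin n → W) × (Fin n → V),
      φ (1 / (n : ℝ) ^ 2 * (∑ i, ∑ j, a (s.1 i) (s.2 j))) ≤
        ∑ r : Fin n, (1 / (n : ℝ)) • φ ((∑ i, a (s.1 i) (s.2 (i + r))) / n) := by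
    intro s
    rw [hshift]
    refine hconv.map_sum_le (fun _ _ => by positivity) (by simp) fun r _ => ?_
    exact div_nonneg (Finset.sum_nonneg fun i _ => ha0 _ _) hn'.le
  have hone : ∀ r : Fin n, ∑ s : (Fin n → W) × (Fin n → V),
      φ ((∑ i, a (s.1 i) (s.2 (i + r))) / n) ≤
        10 * Fintype.card ((Fin n → W) × (Fin n → V)) := by
    intro r
    -- For a fixed shift, `(s, t) ↦ (i ↦ (s i, t (i + r)))` is a bijection onto samples of `n`
    -- pairs, so the one-sample bound applies with `W × V`.
    let ψ : ((Fin n → W) × (Fin n → V)) ≃ (Fin n → W × V) :=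
      ((Equiv.refl _).prodCongr ((Equiv.addRight r).symm.arrowCongr (Equiv.refl _))).trans
        (Equiv.arrowProdEquivProdArrow (Fin n) (fun _ => W) fun _ => V).symm
    have hmain := sum_exp_klFun_mean_le (fun p : W × V => a p.1 p.2) (fun p => ha0 _ _)
      (fun p => ha1 _ _) n hn (q := q) (by
        rw [hq, Fintype.sum_prod_type, Fintype.card_prod, Nat.cast_mul])
    rw [← Equiv.sum_comp ψ] at hmain
    refine le_trans (le_of_eq ?_) (hmain.trans (le_of_eq ?_))
    · refine Finset.sum_congr rfl fun s _ => ?_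
      rfl
    · simp [mul_pow]
  calc ∑ s : (Fin n → W) × (Fin n → V), φ (1 / (n : ℝ) ^ 2 * (∑ i, ∑ j, a (s.1 i) (s.2 j)))
      ≤ ∑ s : (Fin n → W) × (Fin n → V),
          ∑ r : Fin n, (1 / (n : ℝ)) • φ ((∑ i, a (s.1 i) (s.2 (i + r))) / n) :=
        Finset.sum_le_sum fun s _ => hjensen s
    _ = ∑ r : Fin n, (1 / (n : ℝ)) * ∑ s : (Fin n → W) × (Fin n → V),
          φ ((∑ i, a (s.1 i) (s.2 (i + r))) / n) := by
        rw [Finset.sum_comm]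
        simp only [smul_eq_mul, Finset.mul_sum]
    _ ≤ ∑ r : Fin n, (1 / (n : ℝ)) * (10 * Fintype.card ((Fin n → W) × (Fin n → V))) := by
        gcongr with r; exact hone r
    _ = _ := by simp only [Finset.sum_const, Finset.card_univ, Fintype.card_fin, nsmul_eq_mul]
                field_simp

/-- Exponential moment of the total relative entropy over a finite set of outcomes. -/
lemma sum_exp_sum_klFun_le {V ι : Type*} [Fintype V] [Nonempty V] [Nonempty W] [Fintype ι]
    [Nonempty ι] (a : W → V → ι → ℝ) (ha0 : ∀ w v y, 0 ≤ a w v y) (ha1 : ∀ w v y, a w v y ≤ 1)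
    (n κ : ℕ) (hn : 0 < n) (hκ : Fintype.card ι ≤ κ) {q : ι → ℝ}
    (hq : ∀ y, q y = (∑ w, ∑ v, a w v y) / (Fintype.card W * Fintype.card V)) :
    ∑ s : (Fin n → W) × (Fin n → V), Real.exp (n / (2 * κ) * ∑ y,
        q y * klFun (1 / (n : ℝ) ^ 2 * (∑ i, ∑ j, a (s.1 i) (s.2 j) y) / q y)) ≤
      10 * Fintype.card ((Fin n → W) × (Fin n → V)) := by
  have hk : (0 : ℝ) < Fintype.card ι := by exact_mod_cast Fintype.card_pos
  have hkκ : (Fintype.card ι : ℝ) ≤ κ := by exact_mod_cast hκ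
  have hq0 : ∀ y, 0 ≤ q y := fun y => by
    rw [hq]
    exact div_nonneg (Finset.sum_nonneg fun w _ => Finset.sum_nonneg fun v _ => ha0 w v y)
      (by positivity)
  have hp0 : ∀ (s : (Fin n → W) × (Fin n → V)) y,
      0 ≤ q y * klFun (1 / (n : ℝ) ^ 2 * (∑ i, ∑ j, a (s.1 i) (s.2 j) y) / q y) := fun s y =>
    mul_nonneg (hq0 y) (klFun_nonneg (div_nonneg (mul_nonneg (by positivity)
      (Finset.sum_nonneg fun w _ => Finset.sum_nonneg fun v _ => ha0 _ _ _)) (hq0 y)))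
  calc _ ≤ ∑ s : (Fin n → W) × (Fin n → V), ∑ y, (1 / (Fintype.card ι : ℝ)) •
        Real.exp (n / 2 *
          (q y * klFun (1 / (n : ℝ) ^ 2 * (∑ i, ∑ j, a (s.1 i) (s.2 j) y) / q y))) := by
        refine Finset.sum_le_sum fun s _ => ?_
        refine le_trans (Real.exp_le_exp.2 ?_)
          (convexOn_exp.map_sum_le (fun _ _ => by positivity) (by simp)
            fun _ _ => Set.mem_univ _)
        simp only [smul_eq_mul]
        rw [Finset.mul_sum]
        refine Finset.sum_le_sum fun y _ => ?_
        rw [← mul_assoc (1 / (Fintype.card ι : ℝ))]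
        refine mul_le_mul_of_nonneg_right ?_ (hp0 s y)
        rw [div_mul_div_comm, one_mul, mul_comm (2 : ℝ)]
        gcongr
    _ = ∑ y, (1 / (Fintype.card ι : ℝ)) * ∑ s : (Fin n → W) × (Fin n → V),
        Real.exp (n / 2 *
          (q y * klFun (1 / (n : ℝ) ^ 2 * (∑ i, ∑ j, a (s.1 i) (s.2 j) y) / q y))) := by
        rw [Finset.sum_comm]
        simp only [smul_eq_mul, Finset.mul_sum]
    _ ≤ ∑ y : ι, (1 / (Fintype.card ι : ℝ)) * (10 * Fintype.card ((Fin n → W) × (Fin n → V))) := by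
        gcongr with y
        exact sum_exp_klFun_double_mean_le (fun w v => a w v y) (fun w v => ha0 w v y)
          (fun w v => ha1 w v y) n hn (hq y)
    _ = _ := by simp only [Finset.sum_const, Finset.card_univ, nsmul_eq_mul]
                field_simp

end Concentration

/-! ### Relative entropy of finite distributions. -/

section RelativeEntropy

/-- Comparison with the squared Hellinger distance, from `log √u ≥ 1 - 1/√u`. -/
lemma sq_sqrt_sub_one_le_klFun {u : ℝ} (hu : 0 ≤ u) : (√u - 1) ^ 2 ≤ klFun u := by
  rcases hu.eq_or_lt with rfl | hpos
  · simp [InformationTheory.klFun_zero]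
  have hs := Real.sqrt_pos.2 hpos
  have hlog : Real.log u = 2 * Real.log √u := by rw [Real.log_sqrt hu]; ring
  have h := Real.one_sub_inv_le_log_of_pos hs
  have hsq := Real.mul_self_sqrt hu
  rw [klFun_apply, hlog]
  have h2 : u * (1 - (√u)⁻¹) = u - √u := by
    rw [mul_sub, mul_one, ← div_eq_mul_inv, Real.div_sqrt]
  nlinarith [mul_le_mul_of_nonneg_left h hu]

/-- Factor `p - q = (√p - √q)(√p + √q)`: the first factor is controlled by the Hellinger bound, and
the second is at most 2. -/
lemma sq_sub_le_mul_klFun {p q : ℝ} (hp0 : 0 ≤ p) (hp1 : p ≤ 1) (hq0 : 0 < q) (hq1 : q ≤ 1) :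
    (p - q) ^ 2 ≤ 4 * (q * klFun (p / q)) := by
  have h := sq_sqrt_sub_one_le_klFun (div_nonneg hp0 hq0.le)
  have hq := Real.sqrt_pos.2 hq0
  have h1 : (√p - √q) ^ 2 = q * (√(p / q) - 1) ^ 2 := by
    rw [Real.sqrt_div' _ hq0.le]
    nth_rw 2 [← Real.sq_sqrt hq0.le]
    field_simp
  have h2 : p - q = (√p - √q) * (√p + √q) := by
    ring_nf
    rw [Real.sq_sqrt hp0, Real.sq_sqrt hq0.le]
  have h3 : (√p + √q) ^ 2 ≤ 4 := by
    have := Real.sqrt_le_one.2 hp1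
    have := Real.sqrt_le_one.2 hq1
    nlinarith [Real.sqrt_nonneg p]
  calc (p - q) ^ 2 = (√p - √q) ^ 2 * (√p + √q) ^ 2 := by rw [h2]; ring
    _ ≤ (√p - √q) ^ 2 * 4 := by gcongr
    _ ≤ 4 * (q * klFun (p / q)) := by rw [h1]; nlinarith [mul_le_mul_of_nonneg_left h hq0.le]

/-- The chi-square bound, from `log x ≤ x - 1`. -/
lemma mul_klFun_le_sq_sub_div {p q : ℝ} (hp : 0 ≤ p) (hq : 0 < q) :
    q * klFun (p / q) ≤ (p - q) ^ 2 / q := by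
  have h : klFun (p / q) ≤ (p / q - 1) ^ 2 := by
    rw [klFun_apply]
    rcases hp.eq_or_lt with rfl | hp
    · simp
    have := mul_le_mul_of_nonneg_left (Real.log_le_sub_one_of_pos (div_pos hp hq))
      (div_pos hp hq).le
    nlinarith
  calc q * klFun (p / q) ≤ q * (p / q - 1) ^ 2 := by gcongr
    _ = _ := by field_simp

/-- The relative entropies in the two directions are comparable when the probabilities are bounded
below. -/
lemma mul_klFun_swap_le {p q b : ℝ} (hb : 0 < b) (hp : b ≤ p) (hp1 : p ≤ 1) (hq : b ≤ q)
    (hq1 : q ≤ 1) : p * klFun (q / p) ≤ 4 / b * (q * klFun (p / q)) := by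
  have hp0 := hb.trans_le hp
  have hq0 := hb.trans_le hq
  calc p * klFun (q / p) ≤ (q - p) ^ 2 / p := mul_klFun_le_sq_sub_div hq0.le hp0
    _ ≤ (p - q) ^ 2 / b := by rw [← neg_sub, neg_sq]; gcongr
    _ ≤ 4 * (q * klFun (p / q)) / b := by
        gcongr; exact sq_sub_le_mul_klFun hp0.le hp1 hq0 hq1
    _ = _ := by ring

variable {α : Type*} [Fintype α] [MeasurableSpace α] [MeasurableSingletonClass α]

lemma sum_smul_dirac_singleton (p : α → ℝ) (x : α) :
    (∑ y, ENNReal.ofReal (p y) • Measure.dirac y : Measure α) {x} = ENNReal.ofReal (p x) := by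
  classical
  simp [Measure.finsetSum_apply, Set.indicator_apply, Finset.sum_ite_eq']

/-- The density is `p / q`. Since `klFun` carries the mass correction, the weights need not sum to
one. -/
lemma klDiv_sum_smul_dirac (p q : α → ℝ) (hp : ∀ x, 0 ≤ p x) (hq : ∀ x, 0 ≤ q x)
    (hac : ∀ x, q x = 0 → p x = 0) :
    InformationTheory.klDiv (∑ x, ENNReal.ofReal (p x) • Measure.dirac x)
      (∑ x, ENNReal.ofReal (q x) • Measure.dirac x) =
      ENNReal.ofReal (∑ x, q x * klFun (p x / q x)) := by
  set P : Measure α := ∑ x, ENNReal.ofReal (p x) • Measure.dirac x with hP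
  set Q : Measure α := ∑ x, ENNReal.ofReal (q x) • Measure.dirac x with hQ
  have hfinP : IsFiniteMeasure P := ⟨by
    rw [hP, Measure.finsetSum_apply]
    exact ENNReal.sum_lt_top.2 fun x _ => by simp⟩
  have hfinQ : IsFiniteMeasure Q := ⟨by
    rw [hQ, Measure.finsetSum_apply]
    exact ENNReal.sum_lt_top.2 fun x _ => by simp⟩
  have hmeas : Measurable fun x => ENNReal.ofReal (p x / q x) := measurable_of_countable _
  have hdens : P = Q.withDensity fun x => ENNReal.ofReal (p x / q x) := by
    refine Measure.ext_of_singleton fun x => ?_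
    rw [withDensity_apply _ (measurableSet_singleton x), lintegral_singleton,
      sum_smul_dirac_singleton, sum_smul_dirac_singleton,
      ← ENNReal.ofReal_mul (div_nonneg (hp x) (hq x))]
    congr 1
    rcases eq_or_ne (q x) 0 with h | h
    · simp [h, hac x h]
    · field_simp
  have hae : P ≪ Q := hdens ▸ withDensity_absolutelyContinuous _ _
  rw [InformationTheory.klDiv_eq_lintegral_klFun_of_ac hae]
  have hrn : P.rnDeriv Q =ᵐ[Q] fun x => ENNReal.ofReal (p x / q x) := by
    rw [hdens]; exact Measure.rnDeriv_withDensity Q hmeas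
  have hcongr : ∫⁻ x, ENNReal.ofReal (klFun (P.rnDeriv Q x).toReal) ∂Q =
      ∫⁻ x, ENNReal.ofReal (klFun (p x / q x)) ∂Q := by
    refine lintegral_congr_ae ?_
    filter_upwards [hrn] with x hx
    rw [hx, ENNReal.toReal_ofReal (div_nonneg (hp x) (hq x))]
  rw [hcongr, lintegral_fintype, ENNReal.ofReal_sum_of_nonneg fun x _ =>
    mul_nonneg (hq x) (klFun_nonneg (div_nonneg (hp x) (hq x)))]
  refine Finset.sum_congr rfl fun x _ => ?_
  rw [sum_smul_dirac_singleton, mul_comm, ENNReal.ofReal_mul (hq x)]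

end RelativeEntropy

/-! ### From pointwise exponential moments to a probability bound. -/

section Markov

/-- Superadditivity of the lower integral holds for arbitrary functions, so measurability in the
choice event never has to be proved. -/
lemma sum_lintegral_le_lintegral_sum {E S : Type*} [MeasurableSpace E] (D : Measure E)
    (T : Finset S) (f : S → E → ENNReal) :
    ∑ s ∈ T, ∫⁻ e, f s e ∂D ≤ ∫⁻ e, ∑ s ∈ T, f s e ∂D := by
  classical
  induction T using Finset.induction_on with
  | empty => simp
  | insert s T hs ih =>
    simp only [Finset.sum_insert hs]
    exact (add_le_add le_rfl ih).trans (le_lintegral_add _ _)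

/-- Exponential Markov inequality for an average of random variables with bounded exponential
moments. -/
lemma le_uniformOn_lintegral_le {S E : Type*} [Fintype S] [Nonempty S] [MeasurableSpace S]
    [MeasurableSingletonClass S] [MeasurableSpace E] (D : Measure E) [IsProbabilityMeasure D]
    (f : S → E → ENNReal) (g : S → E → ℝ) {θ τ C δ : ℝ} (hθ : 0 < θ) (hτ : 0 ≤ τ) (hC : 0 ≤ C)
    (hfg : ∀ᵐ e ∂D, ∀ s, 0 ≤ g s e ∧ f s e ≤ ENNReal.ofReal (g s e))
    (hexp : ∀ᵐ e ∂D, ∑ s, Real.exp (θ * g s e) ≤ C * Fintype.card S)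
    (hδ : C * Real.exp (-(θ * τ)) ≤ δ) :
    ENNReal.ofReal (1 - δ) ≤ ProbabilityTheory.uniformOn (Set.univ : Set S)
      {s | ∫⁻ e, f s e ∂D ≤ ENNReal.ofReal τ} := by
  classical
  -- Jensen for `exp`, obtained by integrating the tangent inequality `x + 1 ≤ exp x` at `x = θ (g -
  -- τ)`. The term `θ τ` is moved to the other side to avoid subtraction in `ENNReal`.
  have hbad : ∀ s, ¬ ∫⁻ e, f s e ∂D ≤ ENNReal.ofReal τ →
      1 ≤ ∫⁻ e, ENNReal.ofReal (Real.exp (θ * (g s e - τ))) ∂D := by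
    intro s hs
    have h1 : ENNReal.ofReal θ * ∫⁻ e, f s e ∂D + 1 ≤
        ∫⁻ e, ENNReal.ofReal (Real.exp (θ * (g s e - τ))) ∂D + ENNReal.ofReal (θ * τ) :=
      calc ENNReal.ofReal θ * ∫⁻ e, f s e ∂D + 1
          = ∫⁻ e, ENNReal.ofReal θ * f s e ∂D + ∫⁻ _, 1 ∂D := by
            rw [lintegral_const_mul' _ _ ENNReal.ofReal_ne_top]; simp
        _ ≤ ∫⁻ e, (ENNReal.ofReal θ * f s e + 1) ∂D := le_lintegral_add _ _
        _ ≤ ∫⁻ e, (ENNReal.ofReal (Real.exp (θ * (g s e - τ))) + ENNReal.ofReal (θ * τ)) ∂D := by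
            refine lintegral_mono_ae ?_
            filter_upwards [hfg] with e he
            calc ENNReal.ofReal θ * f s e + 1
                ≤ ENNReal.ofReal θ * ENNReal.ofReal (g s e) + ENNReal.ofReal 1 := by
                  rw [ENNReal.ofReal_one]; gcongr; exact (he s).2
              _ = ENNReal.ofReal (θ * g s e + 1) := by
                  rw [← ENNReal.ofReal_mul hθ.le,
                    ← ENNReal.ofReal_add (mul_nonneg hθ.le (he s).1) zero_le_one]
              _ ≤ ENNReal.ofReal (Real.exp (θ * (g s e - τ)) + θ * τ) := by
                  refine ENNReal.ofReal_le_ofReal ?_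
                  have := Real.add_one_le_exp (θ * (g s e - τ))
                  linarith
              _ = _ := ENNReal.ofReal_add (Real.exp_pos _).le (by positivity)
        _ = _ := by rw [lintegral_add_right _ measurable_const]; simp
    have h2 : ENNReal.ofReal (θ * τ) ≤ ENNReal.ofReal θ * ∫⁻ e, f s e ∂D := by
      rw [ENNReal.ofReal_mul hθ.le]
      gcongr
      exact (not_le.1 hs).le
    have h3 := (add_le_add h2 (le_refl 1)).trans h1
    rw [add_comm] at h3
    exact (ENNReal.add_le_add_iff_right ENNReal.ofReal_ne_top).1 h3
  set B := Finset.univ.filter fun s => ¬ ∫⁻ e, f s e ∂D ≤ ENNReal.ofReal τ with hB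
  set G := Finset.univ.filter fun s => ∫⁻ e, f s e ∂D ≤ ENNReal.ofReal τ with hG
  have hcard : (B.card : ENNReal) ≤ ENNReal.ofReal (δ * Fintype.card S) :=
    calc (B.card : ENNReal) = ∑ s ∈ B, 1 := by simp
      _ ≤ ∑ s ∈ B, ∫⁻ e, ENNReal.ofReal (Real.exp (θ * (g s e - τ))) ∂D :=
          Finset.sum_le_sum fun s hs => hbad s (Finset.mem_filter.1 hs).2
      _ ≤ ∑ s, ∫⁻ e, ENNReal.ofReal (Real.exp (θ * (g s e - τ))) ∂D :=
          Finset.sum_le_sum_of_subset (Finset.subset_univ _)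
      _ ≤ ∫⁻ e, ∑ s, ENNReal.ofReal (Real.exp (θ * (g s e - τ))) ∂D :=
          sum_lintegral_le_lintegral_sum _ _ _
      _ ≤ ∫⁻ _, ENNReal.ofReal (δ * Fintype.card S) ∂D := by
          refine lintegral_mono_ae ?_
          filter_upwards [hexp] with e he
          rw [← ENNReal.ofReal_sum_of_nonneg fun s _ => (Real.exp_pos _).le]
          refine ENNReal.ofReal_le_ofReal ?_
          calc ∑ s, Real.exp (θ * (g s e - τ))
              = (∑ s, Real.exp (θ * g s e)) * Real.exp (-(θ * τ)) := by
                rw [Finset.sum_mul]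
                refine Finset.sum_congr rfl fun s _ => ?_
                rw [← Real.exp_add]; ring_nf
            _ ≤ C * Fintype.card S * Real.exp (-(θ * τ)) := by gcongr
            _ = C * Real.exp (-(θ * τ)) * Fintype.card S := by ring
            _ ≤ _ := by gcongr
      _ = _ := by simp
  have hδ0 : 0 ≤ δ := le_trans (by positivity) hδ
  have hcard' : (B.card : ℝ) ≤ δ * Fintype.card S := by
    rw [← ENNReal.ofReal_natCast] at hcard
    exact (ENNReal.ofReal_le_ofReal_iff (by positivity)).1 hcard
  have hsum : (G.card : ℝ) + B.card = Fintype.card S := by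
    exact_mod_cast Finset.card_filter_add_card_filter_not (s := Finset.univ)
      (fun s => ∫⁻ e, f s e ∂D ≤ ENNReal.ofReal τ)
  have hset : {s | ∫⁻ e, f s e ∂D ≤ ENNReal.ofReal τ} = (G : Set S) := by
    ext s; simp [hG]
  have hS : (0 : ℝ) < Fintype.card S := by exact_mod_cast Fintype.card_pos
  rw [ProbabilityTheory.uniformOn_univ, hset, Measure.count_apply_finset,
    ← ENNReal.ofReal_natCast, ← ENNReal.ofReal_natCast, ← ENNReal.ofReal_div_of_pos hS]
  refine ENNReal.ofReal_le_ofReal ?_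
  rw [le_div_iff₀ hS]
  linarith

end Markov

namespace RUMnet

/-! ### The Gumbel law and lower bounds on winning probabilities. -/

section Gumbel

lemma hasDerivAt_exp_neg_exp_neg (t : ℝ) :
    HasDerivAt (fun t => Real.exp (-Real.exp (-t))) (Real.exp (-(t + Real.exp (-t)))) t := by
  have h := (((hasDerivAt_id t).neg.exp).neg).exp
  refine h.congr_deriv ?_
  simp only [id, Pi.neg_apply, neg_add, Real.exp_add]
  ring

/-- The distribution function of the standard Gumbel law. -/
lemma gumbel_Iic (t : ℝ) : gumbel (Set.Iic t) = ENNReal.ofReal (Real.exp (-Real.exp (-t))) := by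
  have hlim : Filter.Tendsto (fun t : ℝ => Real.exp (-Real.exp (-t))) Filter.atBot (nhds 0) :=
    Real.tendsto_exp_atBot.comp (Filter.tendsto_neg_atTop_atBot.comp
      (Real.tendsto_exp_atTop.comp Filter.tendsto_neg_atBot_atTop))
  have hcont : Continuous fun t : ℝ => Real.exp (-(t + Real.exp (-t))) := by fun_prop
  -- The primitive takes values in `[0,1]`, which bounds the integral over every compact interval by
  -- 1.
  have hint : IntegrableOn (fun t => Real.exp (-(t + Real.exp (-t)))) (Set.Iic t) := by
    refine integrableOn_Iic_of_intervalIntegral_norm_bounded (a := fun i : ℝ => i) 1 t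
      (fun i => hcont.integrableOn_Ioc) Filter.tendsto_id (Filter.Eventually.of_forall fun i => ?_)
    simp only [Real.norm_eq_abs, Real.abs_exp]
    rw [intervalIntegral.integral_eq_sub_of_hasDerivAt
      (fun x _ => hasDerivAt_exp_neg_exp_neg x) (hcont.intervalIntegrable _ _)]
    have h1 : Real.exp (-Real.exp (-t)) ≤ 1 := Real.exp_le_one_iff.2 (by
      have := Real.exp_pos (-t); linarith)
    have h2 := Real.exp_pos (-Real.exp (-i))
    linarith
  rw [gumbel, withDensity_apply _ measurableSet_Iic,
    ← ofReal_integral_eq_lintegral_ofReal hint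
      (Filter.Eventually.of_forall fun x => (Real.exp_pos _).le),
    integral_Iic_of_hasDerivAt_of_tendsto' (fun x _ => hasDerivAt_exp_neg_exp_neg x) hint hlim,
    sub_zero]

/-- With Gumbel shocks and utilities in `[-b, b]`, each of at most `κ` alternatives is chosen with
probability at least `1 / (2 e κ e^{2b})`. -/
lemma le_gumbel_pi_real_argmax {ι : Type*} [Fintype ι] [IsProbabilityMeasure gumbel] {κ : ℕ}
    (hκ : Fintype.card ι ≤ κ) (u : ι → ℝ) {b : ℝ} (hb : 0 ≤ b) (hu : ∀ i, |u i| ≤ b) (x : ι) :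
    1 / (2 * Real.exp 1 * (κ * Real.exp (2 * b))) ≤
      (Measure.pi fun _ : ι => gumbel).real
        {δ | ∀ x', x' ≠ x → u x' + δ x' < u x + δ x} := by
  classical
  have hκ1 : (1 : ℝ) ≤ κ := by
    have : 0 < Fintype.card ι := Fintype.card_pos_iff.2 ⟨x⟩
    exact_mod_cast this.trans_le hκ
  set Y := (κ : ℝ) * Real.exp (2 * b) with hY
  have hY1 : 1 ≤ Y := by
    have : 1 ≤ Real.exp (2 * b) := Real.one_le_exp (by positivity)
    nlinarith
  have hY0 : 0 < Y := by linarith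
  -- `x` wins if its shock exceeds `t₀` and all others are at most `t₀ - 2b`. With `t₀ = log (κ
  -- e^{2b})` each other shock complies with probability `exp (-1/κ)`, so together they cost at most
  -- a factor `e`, while the tail for `x` is at least `1 / (2Y)`.
  set t₀ := Real.log Y with ht₀
  have hexp : Real.exp (-t₀) = Y⁻¹ := by rw [Real.exp_neg, Real.exp_log hY0]
  set B : ι → Set ℝ := fun i => if i = x then Set.Ioi t₀ else Set.Iic (t₀ - 2 * b) with hB
  have hsub : Set.univ.pi B ⊆ {δ | ∀ x', x' ≠ x → u x' + δ x' < u x + δ x} := by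
    intro δ hδ x' hx'
    have h1 := hδ x (Set.mem_univ x)
    have h2 := hδ x' (Set.mem_univ x')
    simp only [hB, if_true, if_neg hx', Set.mem_Ioi, Set.mem_Iic] at h1 h2
    have h3 := abs_le.1 (hu x)
    have h4 := abs_le.1 (hu x')
    linarith
  have hIoi : 1 / (2 * Y) ≤ gumbel.real (Set.Ioi t₀) := by
    have h := probReal_compl_eq_one_sub (μ := gumbel) (measurableSet_Iic (a := t₀))
    rw [Set.compl_Iic] at h
    rw [h, Measure.real, gumbel_Iic, ENNReal.toReal_ofReal (Real.exp_pos _).le, hexp]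
    have hz0 : 0 < Y⁻¹ := by positivity
    have hz1 : Y⁻¹ ≤ 1 := inv_le_one_of_one_le₀ hY1
    have h1 : Real.exp (-Y⁻¹) ≤ 1 / (1 + Y⁻¹) := by
      rw [Real.exp_neg, ← one_div]
      gcongr
      linarith [Real.add_one_le_exp Y⁻¹]
    have h2 : 1 / (1 + Y⁻¹) ≤ 1 - Y⁻¹ / 2 := by
      rw [div_le_iff₀ (by positivity)]
      nlinarith
    have h3 : 1 / (2 * Y) = Y⁻¹ / 2 := by field_simp
    linarith
  have hIic : gumbel.real (Set.Iic (t₀ - 2 * b)) = Real.exp (-(1 / κ)) := by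
    rw [Measure.real, gumbel_Iic, ENNReal.toReal_ofReal (Real.exp_pos _).le]
    have : Real.exp (-(t₀ - 2 * b)) = 1 / κ := by
      rw [show -(t₀ - 2 * b) = -t₀ + 2 * b by ring, Real.exp_add, hexp, hY]
      field_simp
    rw [this]
  have hprod : (Measure.pi fun _ : ι => gumbel).real (Set.univ.pi B) =
      gumbel.real (Set.Ioi t₀) * Real.exp (-(1 / κ)) ^ (Fintype.card ι - 1) := by
    rw [Measure.real, Measure.pi_pi, ENNReal.toReal_prod,
      ← Finset.mul_prod_erase _ _ (Finset.mem_univ x)]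
    congr 1
    · simp [hB, Measure.real]
    · rw [Finset.prod_congr rfl (g := fun _ => Real.exp (-(1 / κ)))]
      · simp [Finset.card_erase_of_mem]
      · intro i hi
        rw [← hIic]
        simp [hB, Finset.ne_of_mem_erase hi, Measure.real]
  have hpow : Real.exp (-1) ≤ Real.exp (-(1 / κ)) ^ (Fintype.card ι - 1) := by
    rw [← Real.exp_nat_mul]
    refine Real.exp_le_exp.2 ?_
    have h1 : ((Fintype.card ι - 1 : ℕ) : ℝ) ≤ κ := by exact_mod_cast (Nat.sub_le _ _).trans hκ
    have h2 : ((Fintype.card ι - 1 : ℕ) : ℝ) * (1 / κ) ≤ 1 := by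
      rw [mul_one_div, div_le_one (by linarith)]; exact h1
    linarith
  refine le_trans ?_ (measureReal_mono hsub)
  rw [hprod]
  calc 1 / (2 * Real.exp 1 * Y) = 1 / (2 * Y) * Real.exp (-1) := by
        rw [Real.exp_neg]; field_simp
    _ ≤ _ := by gcongr

end Gumbel

/-! ### Boundedness of network outputs. -/

section Network

/-- Only the last two layers matter: depth at least 2 puts a hidden layer, with outputs in `[-1,1]`,
before the output neurons, whose weighted sums are then at most `M` in absolute value. -/
lemma FeedForwardNet.abs_eval_le {ℓ w : ℕ} {M : ℝ} {m n : ℕ} (f : FeedForwardNet ℓ w M m n)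
    {σ σout : ℝ → ℝ} (hℓ : 2 ≤ ℓ) (hσ : ∀ t, |σ t| ≤ 1) (hσout : ∀ t, |σout t| ≤ max 1 |t|)
    (x : Fin m → ℝ) (i : Fin n) : |f.eval σ σout x i| ≤ max 1 M := by
  obtain ⟨k, rfl⟩ : ∃ k, ℓ = k + 2 := ⟨ℓ - 2, by omega⟩
  have hhid : ∀ j, |f.layerOutput σ σout x (k + 1) j| ≤ 1 := by
    intro j
    rw [FeedForwardNet.layerOutput, if_neg (by omega)]
    exact hσ _
  have hout : ∀ j, |f.layerOutput σ σout x (k + 2) j| ≤ max 1 M := by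
    intro j
    rw [FeedForwardNet.layerOutput, if_pos rfl]
    refine (hσout _).trans (max_le_max le_rfl ?_)
    refine (Finset.abs_sum_le_sum_abs _ _).trans (le_trans ?_ (f.norm_weight (k + 1) (by omega) j))
    refine Finset.sum_le_sum fun i _ => ?_
    rw [abs_mul]
    exact mul_le_of_le_one_right (abs_nonneg _) (hhid i)
  exact hout _

end Network

/-! ### Choice probabilities as double averages. -/

namespace Architecture

variable {dx dε dz dν K ℓ w : ℕ} {M : ℝ}

/-- The choice probability of `x` for given samples of the unobserved attributes. -/
noncomputable def sampleChoiceProb (N : Architecture dx dε dz dν K ℓ w M) (σ σout : ℝ → ℝ) (μ : Measure ℝ)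
    (e : ChoiceEvent dx dz) (k₁ k₂ : Fin K) (x : e.A) : ℝ :=
  (Measure.pi fun _ : e.A => μ).real
    {δ | ∀ x' : e.A, x' ≠ x →
      N.sampleUtility σ σout k₁ k₂ x' e.z + δ x' < N.sampleUtility σ σout k₁ k₂ x e.z + δ x}

variable (N : Architecture dx dε dz dν K ℓ w M) (σ σout : ℝ → ℝ) (μ : Measure ℝ)
  (e : ChoiceEvent dx dz)

lemma choiceProb_eq (x : e.A) : N.choiceProb σ σout μ e x =
    1 / (K : ℝ) ^ 2 * ∑ k₁, ∑ k₂, N.sampleChoiceProb σ σout μ e k₁ k₂ x := rfl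

lemma choiceProb_resample {K' : ℕ} (s : (Fin K' → Fin K) × (Fin K' → Fin K)) (x : e.A) :
    (N.resample s).choiceProb σ σout μ e x =
      1 / (K' : ℝ) ^ 2 * ∑ i, ∑ j, N.sampleChoiceProb σ σout μ e (s.1 i) (s.2 j) x := rfl

lemma sampleChoiceProb_nonneg (k₁ k₂ : Fin K) (x : e.A) :
    0 ≤ N.sampleChoiceProb σ σout μ e k₁ k₂ x := measureReal_nonneg

lemma sampleChoiceProb_le_one [IsProbabilityMeasure μ] (k₁ k₂ : Fin K) (x : e.A) :
    N.sampleChoiceProb σ σout μ e k₁ k₂ x ≤ 1 := measureReal_le_one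

lemma choiceProb_nonneg (x : e.A) : 0 ≤ N.choiceProb σ σout μ e x := by
  rw [choiceProb_eq]
  exact mul_nonneg (by positivity) (Finset.sum_nonneg fun _ _ => Finset.sum_nonneg fun _ _ =>
    N.sampleChoiceProb_nonneg σ σout μ e _ _ x)

lemma choiceProb_le_one [IsProbabilityMeasure μ] (x : e.A) : N.choiceProb σ σout μ e x ≤ 1 := by
  rw [choiceProb_eq, one_div, ← div_eq_inv_mul]
  refine div_le_one_of_le₀ ?_ (by positivity)
  calc _ ≤ ∑ _k₁ : Fin K, ∑ _k₂ : Fin K, (1 : ℝ) :=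
        Finset.sum_le_sum fun _ _ => Finset.sum_le_sum fun _ _ =>
          N.sampleChoiceProb_le_one σ σout μ e _ _ x
    _ = _ := by simp [sq]

lemma le_choiceProb (hK : 1 ≤ K) (x : e.A) {b : ℝ}
    (h : ∀ k₁ k₂, b ≤ N.sampleChoiceProb σ σout μ e k₁ k₂ x) :
    b ≤ N.choiceProb σ σout μ e x := by
  have hK' : (0 : ℝ) < K := by exact_mod_cast hK
  rw [choiceProb_eq, one_div, ← div_eq_inv_mul, le_div_iff₀ (by positivity)]
  calc b * (K : ℝ) ^ 2 = ∑ _k₁ : Fin K, ∑ _k₂ : Fin K, b := by simp; ring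
    _ ≤ _ := Finset.sum_le_sum fun _ _ => Finset.sum_le_sum fun _ _ => h _ _

/-- A vanishing average of nonnegative terms has only zero terms. This gives the absolute continuity
that keeps the forward divergence finite for every draw. -/
lemma choiceProb_resample_eq_zero (hK : 1 ≤ K) {K' : ℕ}
    (s : (Fin K' → Fin K) × (Fin K' → Fin K)) (x : e.A) (h : N.choiceProb σ σout μ e x = 0) :
    (N.resample s).choiceProb σ σout μ e x = 0 := by
  have hK' : (K : ℝ) ≠ 0 := by exact_mod_cast (by omega : K ≠ 0)
  have h0 : ∀ k₁ k₂, N.sampleChoiceProb σ σout μ e k₁ k₂ x = 0 := by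
    have hnn := N.sampleChoiceProb_nonneg σ σout μ e
    have hsum := (mul_eq_zero.1 (N.choiceProb_eq σ σout μ e x ▸ h)).resolve_left (by positivity)
    intro k₁ k₂
    have h1 := (Finset.sum_eq_zero_iff_of_nonneg fun _ _ => Finset.sum_nonneg fun _ _ =>
      hnn _ _ x).1 hsum k₁ (Finset.mem_univ _)
    exact (Finset.sum_eq_zero_iff_of_nonneg fun _ _ => hnn _ _ x).1 h1 k₂ (Finset.mem_univ _)
  simp [choiceProb_resample, h0]

/-- The relative entropy on the assortment is a finite sum. -/
lemma klDiv_choiceDist {K₂ : ℕ} (N₂ : Architecture dx dε dz dν K₂ ℓ w M)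
    (hac : ∀ x, N₂.choiceProb σ σout μ e x = 0 → N.choiceProb σ σout μ e x = 0) :
    InformationTheory.klDiv (N.choiceDist σ σout μ e) (N₂.choiceDist σ σout μ e) =
      ENNReal.ofReal (∑ x, N₂.choiceProb σ σout μ e x *
        klFun (N.choiceProb σ σout μ e x / N₂.choiceProb σ σout μ e x)) :=
  klDiv_sum_smul_dirac _ _ (N.choiceProb_nonneg σ σout μ e) (N₂.choiceProb_nonneg σ σout μ e) hac

end Architecture

/-! ### Comparison of the two directions under Gumbel shocks. -/

section Gumbel

variable {dx dε dz dν K ℓ w : ℕ} {M : ℝ}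

/-- Choice probabilities are bounded below when the shocks are Gumbel and the activation functions
are bounded. -/
lemma le_choiceProb_gumbel [IsProbabilityMeasure gumbel]
    (N : Architecture dx dε dz dν K ℓ w M) {σ σout : ℝ → ℝ} (hK : 1 ≤ K) (hM : 0 ≤ M)
    (hℓ : 2 ≤ ℓ) (hσ : ∀ t, |σ t| ≤ 1) (hσout : ∀ t, |σout t| ≤ max 1 |t|) {κ : ℕ}
    (e : ChoiceEvent dx dz) (hκ : e.A.card ≤ κ) (x : e.A) :
    1 / (64 * (κ * Real.exp (2 * M))) ≤ N.choiceProb σ σout gumbel e x := by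
  refine N.le_choiceProb σ σout gumbel e hK x fun k₁ k₂ => ?_
  refine le_trans ?_ (le_gumbel_pi_real_argmax (κ := κ) (by simpa using hκ)
    (fun x : e.A => N.sampleUtility σ σout k₁ k₂ x e.z) (b := max 1 M) (by positivity)
    (fun y => N.utility.abs_eval_le hℓ hσ hσout _ 0) x)
  have hκ1 : (1 : ℝ) ≤ κ := by
    exact_mod_cast (Finset.card_pos.2 ⟨x.1, x.2⟩).trans_le hκ
  have he : Real.exp 1 ≤ 2.7183 := (Real.exp_one_lt_d9.trans (by norm_num)).le
  -- Replacing `max 1 M` by `1 + M` costs `e ^ 2`; the total constant `2 e ^ 3` is rounded up to 64.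
  have h1 : Real.exp (2 * max 1 M) ≤ Real.exp 1 ^ 2 * Real.exp (2 * M) := by
    rw [← Real.exp_nat_mul, ← Real.exp_add]
    refine Real.exp_le_exp.2 ?_
    have : max 1 M ≤ 1 + M := max_le (by linarith) (by linarith)
    push_cast
    linarith
  have h2 : Real.exp 1 ^ 3 ≤ 32 :=
    (pow_le_pow_left₀ (Real.exp_pos 1).le he 3).trans (by norm_num)
  refine one_div_le_one_div_of_le (by positivity) ?_
  calc 2 * Real.exp 1 * (κ * Real.exp (2 * max 1 M))
      ≤ 2 * Real.exp 1 * (κ * (Real.exp 1 ^ 2 * Real.exp (2 * M))) := by gcongr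
    _ = 2 * Real.exp 1 ^ 3 * (κ * Real.exp (2 * M)) := by ring
    _ ≤ 2 * 32 * (κ * Real.exp (2 * M)) := by gcongr
    _ = _ := by ring

/-- With Gumbel shocks and bounded activation functions, the two directions of the expected
relative entropy are comparable. -/
lemma expectedKL_swap_le [IsProbabilityMeasure gumbel] {K₂ κ : ℕ}
    (N : Architecture dx dε dz dν K ℓ w M) (N₂ : Architecture dx dε dz dν K₂ ℓ w M)
    {σ σout : ℝ → ℝ} (hK : 1 ≤ K) (hK₂ : 1 ≤ K₂) (hM : 0 ≤ M)
    (hℓ : 2 ≤ ℓ) (hσ : ∀ t, |σ t| ≤ 1) (hσout : ∀ t, |σout t| ≤ max 1 |t|)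
    (D : Measure (ChoiceEvent dx dz)) (hD : ∀ᵐ e ∂D, e.A.Nonempty ∧ e.A.card ≤ κ) :
    expectedKL σ σout gumbel D N N₂ ≤
      ENNReal.ofReal (256 * (κ * Real.exp (2 * M))) * expectedKL σ σout gumbel D N₂ N := by
  rw [expectedKL, expectedKL, ← lintegral_const_mul' _ _ ENNReal.ofReal_ne_top]
  refine lintegral_mono_ae ?_
  filter_upwards [hD] with e ⟨hne, hκ⟩
  have hκ1 : (0 : ℝ) < κ := by exact_mod_cast hne.card_pos.trans_le hκ
  have hb : 0 < 1 / (64 * (κ * Real.exp (2 * M))) := by positivity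
  have h1 := le_choiceProb_gumbel N hK hM hℓ hσ hσout e hκ
  have h2 := le_choiceProb_gumbel N₂ hK₂ hM hℓ hσ hσout e hκ
  rw [N.klDiv_choiceDist σ σout gumbel e N₂ fun x h => absurd h (hb.trans_le (h2 x)).ne',
    N₂.klDiv_choiceDist σ σout gumbel e N fun x h => absurd h (hb.trans_le (h1 x)).ne',
    ← ENNReal.ofReal_mul (by positivity), Finset.mul_sum]
  refine ENNReal.ofReal_le_ofReal (Finset.sum_le_sum fun x _ => ?_)
  refine (mul_klFun_swap_le hb (h2 x) (N₂.choiceProb_le_one σ σout gumbel e x) (h1 x)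
    (N.choiceProb_le_one σ σout gumbel e x)).trans (le_of_eq ?_)
  congr 1
  field_simp
  norm_num

end Gumbel

/-! ### Arithmetic of the sample size. -/

section SampleSize

/-- The absolute constant in the number of samples. -/
noncomputable def sampleConstant : ℝ := Real.exp (-1280)

/-- The logarithmic factor serves only as a large constant: the squared sample constant is
`e^{-2560}`, so the logarithm is at least 2560, and the prefactor `1/2` leaves 1280. -/
lemma le_numSamples {κ ℓ : ℕ} {M ε δ : ℝ} (hκ : 1 ≤ κ) (hM : 0 ≤ M) (hε : 0 < ε) (hε1 : ε ≤ 1)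
    (hδ : 0 < δ) (hδ1 : δ ≤ 1 / 2) :
    1280 / ε ^ 2 * Real.log (1 / δ) * ((κ : ℝ) * Real.exp (2 * M)) ^ 2 ≤
      numSamples sampleConstant sampleConstant κ ℓ M ε δ := by
  have hκ' : (1 : ℝ) ≤ κ := by exact_mod_cast hκ
  have hlog : 0 ≤ Real.log (1 / δ) := Real.log_nonneg (by rw [le_div_iff₀ hδ]; linarith)
  refine le_trans ?_ (Nat.le_ceil _)
  have hc : max (sampleConstant ^ 2) (sampleConstant ^ 2) = (Real.exp 2560)⁻¹ := by
    rw [max_self, sampleConstant, ← Real.exp_nat_mul, ← Real.exp_neg]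
    norm_num
  have hL : 2560 ≤ Real.log (⌈16 / (max (sampleConstant ^ 2) (sampleConstant ^ 2) * ε ^ 2) *
      (κ : ℝ) ^ 3 * Real.exp (4 * M) * (max 1 M) ^ (2 * ℓ)⌉₊ : ℝ) := by
    rw [hc]
    rw [Real.le_log_iff_exp_le]
    · refine le_trans ?_ (Nat.le_ceil _)
      have h1 : Real.exp 2560 ≤ 16 / ((Real.exp 2560)⁻¹ * ε ^ 2) := by
        rw [le_div_iff₀ (by positivity), ← mul_assoc, mul_inv_cancel₀ (Real.exp_pos _).ne']
        nlinarith
      have h2 : (1 : ℝ) ≤ (κ : ℝ) ^ 3 := one_le_pow₀ hκ'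
      have h3 : 1 ≤ Real.exp (4 * M) := Real.one_le_exp (by positivity)
      have h4 : (1 : ℝ) ≤ max 1 M ^ (2 * ℓ) := one_le_pow₀ (le_max_left _ _)
      calc Real.exp 2560 = Real.exp 2560 * 1 * 1 * 1 := by ring
        _ ≤ _ := by gcongr
    · have : 0 < max 1 M := lt_max_of_lt_left one_pos
      exact_mod_cast Nat.ceil_pos.2 (by positivity)
  calc 1280 / ε ^ 2 * Real.log (1 / δ) * ((κ : ℝ) * Real.exp (2 * M)) ^ 2
      = 1 / (2 * ε ^ 2) * Real.log (1 / δ) * ((κ : ℝ) * Real.exp (2 * M)) ^ 2 * 2560 := by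
        field_simp
        ring
    _ ≤ _ := by gcongr

/-- As `1280 / (2 * 128) = 5`, the exponential is at most `δ ^ 5`, and `δ ≤ 1/2` lets `δ ^ 4` absorb
the factor 10. -/
lemma exp_neg_le_of_le_numSamples {κ : ℕ} {M ε δ n : ℝ} (hκ : 1 ≤ κ) (hM : 0 ≤ M) (hε : 0 < ε)
    (hε1 : ε ≤ 1) (hδ : 0 < δ) (hδ1 : δ ≤ 1 / 2)
    (hn : 1280 / ε ^ 2 * Real.log (1 / δ) * ((κ : ℝ) * Real.exp (2 * M)) ^ 2 ≤ n) :
    10 * Real.exp (-(n / (2 * κ) * (ε / (128 * (κ * Real.exp (2 * M)))))) ≤ δ := by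
  have hκ' : (1 : ℝ) ≤ κ := by exact_mod_cast hκ
  have hE : 1 ≤ Real.exp (2 * M) := Real.one_le_exp (by positivity)
  have hδinv : 2 ≤ 1 / δ := by rw [le_div_iff₀ hδ]; linarith
  have hlog : 0 ≤ Real.log (1 / δ) := Real.log_nonneg (by linarith)
  have h1 : 5 * Real.log (1 / δ) ≤ n / (2 * κ) * (ε / (128 * (κ * Real.exp (2 * M)))) :=
    calc 5 * Real.log (1 / δ) = 5 * Real.log (1 / δ) * (1 / 1 * 1) := by ring
      _ ≤ 5 * Real.log (1 / δ) * (1 / ε * Real.exp (2 * M)) := by gcongr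
      _ = 1280 / ε ^ 2 * Real.log (1 / δ) * ((κ : ℝ) * Real.exp (2 * M)) ^ 2 / (2 * κ) *
          (ε / (128 * (κ * Real.exp (2 * M)))) := by field_simp; ring
      _ ≤ _ := by gcongr
  have h2 : Real.exp (-(5 * Real.log (1 / δ))) = δ ^ 5 := by
    rw [one_div, Real.log_inv, mul_neg, neg_neg]
    have := Real.exp_nat_mul (Real.log δ) 5
    rw [Real.exp_log hδ] at this
    exact_mod_cast this
  calc 10 * Real.exp (-(n / (2 * κ) * (ε / (128 * (κ * Real.exp (2 * M))))))
      ≤ 10 * Real.exp (-(5 * Real.log (1 / δ))) := by gcongr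
    _ = 10 * δ ^ 4 * δ := by rw [h2]; ring
    _ ≤ 10 * (1 / 2) ^ 4 * δ := by gcongr
    _ ≤ δ := by linarith

end SampleSize

/-! ### Assembly of the two bounds. -/

/-- Concentration of the expected relative entropy of the resampled architecture. -/
lemma le_uniformOn_expectedKL_resample_le {dx dε dz dν K ℓ w κ : ℕ} {M τ δ : ℝ}
    (σ σout : ℝ → ℝ) (μ : Measure ℝ) [IsProbabilityMeasure μ] (D : Measure (ChoiceEvent dx dz))
    [IsProbabilityMeasure D] (N : Architecture dx dε dz dν K ℓ w M) {n : ℕ} (hn : 0 < n)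
    (hK : 1 ≤ K) (hκ : 1 ≤ κ) (hτ : 0 ≤ τ) (hD : ∀ᵐ e ∂D, e.A.Nonempty ∧ e.A.card ≤ κ)
    (hδ : 10 * Real.exp (-((n : ℝ) / (2 * κ) * τ)) ≤ δ) :
    ENNReal.ofReal (1 - δ) ≤
      ProbabilityTheory.uniformOn (Set.univ : Set ((Fin n → Fin K) × (Fin n → Fin K)))
        {s | expectedKL σ σout μ D (N.resample s) N ≤ ENNReal.ofReal τ} := by
  have : NeZero K := ⟨by omega⟩
  have hn' : (0 : ℝ) < n := by exact_mod_cast hn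
  have hκ' : (0 : ℝ) < κ := by exact_mod_cast hκ
  refine le_uniformOn_lintegral_le D _
    (fun s e => ∑ x, N.choiceProb σ σout μ e x *
      klFun ((N.resample s).choiceProb σ σout μ e x / N.choiceProb σ σout μ e x))
    (θ := n / (2 * κ)) (C := 10) (by positivity) hτ (by norm_num) ?_ ?_ hδ
  · refine Filter.Eventually.of_forall fun e s => ⟨?_, ?_⟩
    · exact Finset.sum_nonneg fun x _ => mul_nonneg (N.choiceProb_nonneg σ σout μ e x)
        (klFun_nonneg (div_nonneg ((N.resample s).choiceProb_nonneg σ σout μ e x)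
          (N.choiceProb_nonneg σ σout μ e x)))
    · exact ((N.resample s).klDiv_choiceDist σ σout μ e N
        (N.choiceProb_resample_eq_zero σ σout μ e hK s)).le
  · filter_upwards [hD] with e ⟨hne, hcard⟩
    have : Nonempty e.A := hne.to_subtype
    refine sum_exp_sum_klFun_le (N.sampleChoiceProb σ σout μ e)
      (N.sampleChoiceProb_nonneg σ σout μ e) (N.sampleChoiceProb_le_one σ σout μ e) n κ hn
      (by simpa using hcard) (q := N.choiceProb σ σout μ e) fun y => ?_
    rw [N.choiceProb_eq, Fintype.card_fin, sq, one_div, div_eq_inv_mul]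

end RUMnet

theorem proposition4 :
    ∃ c₁ c₂ : ℝ, 0 < c₁ ∧ 0 < c₂ ∧
      ∀ (dx dε dz dν K ℓ w κ : ℕ) (M ε δ : ℝ) (σ σout : ℝ → ℝ) (μ : Measure ℝ)
        (𝒳 : Set (Fin dx → ℝ)) (𝒵 : Set (Fin dz → ℝ))
        (D : Measure (RUMnet.ChoiceEvent dx dz))
        (N : RUMnet.Architecture dx dε dz dν K ℓ w M) (K' : ℕ),
        1 ≤ K → 0 ≤ M → 0 < ε → ε ≤ 1 → 0 < δ → δ ≤ 1 / 2 →
        Measurable σ → Measurable σout →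
        IsProbabilityMeasure μ → RUMnet.HasPositiveDensity μ →
        IsCompact 𝒳 → IsCompact 𝒵 →
        IsProbabilityMeasure D →
        (∀ᵐ e ∂D, e.z ∈ 𝒵 ∧ (e.A : Set (Fin dx → ℝ)) ⊆ 𝒳 ∧ e.A.Nonempty ∧ e.A.card ≤ κ) →
        RUMnet.numSamples c₁ c₂ κ ℓ M ε δ ≤ K' →
        (ENNReal.ofReal (1 - δ) ≤
          ProbabilityTheory.uniformOn (Set.univ : Set ((Fin K' → Fin K) × (Fin K' → Fin K)))
            {s | RUMnet.expectedKL σ σout μ D (N.resample s) N ≤ ENNReal.ofReal (3 * ε)}) ∧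
        (μ = RUMnet.gumbel → 2 ≤ ℓ → (∀ t, |σ t| ≤ 1) → (∀ t, |σout t| ≤ max 1 |t|) →
          ENNReal.ofReal (1 - δ) ≤
            ProbabilityTheory.uniformOn (Set.univ : Set ((Fin K' → Fin K) × (Fin K' → Fin K)))
              {s | RUMnet.expectedKL σ σout μ D N (N.resample s) ≤ ENNReal.ofReal (3 * ε)}) := by
  refine ⟨RUMnet.sampleConstant, RUMnet.sampleConstant, Real.exp_pos _, Real.exp_pos _, ?_⟩
  intro dx dε dz dν K ℓ w κ M ε δ σ σout μ 𝒳 𝒵 D N K' hK hM hε hε1 hδ hδ1 _ _ hμ _ _ _ hD hae hK'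
  have hD' : ∀ᵐ e ∂D, e.A.Nonempty ∧ e.A.card ≤ κ := hae.mono fun e he => he.2.2
  -- A probability measure charges some event, and its assortment is nonempty.
  have hκ : 1 ≤ κ := by
    obtain ⟨e, hne, hcard⟩ := hD'.exists
    exact hne.card_pos.trans_le hcard
  have hκ' : (1 : ℝ) ≤ κ := by exact_mod_cast hκ
  have hY : 1 ≤ (κ : ℝ) * Real.exp (2 * M) :=
    one_le_mul_of_one_le_of_one_le hκ' (Real.one_le_exp (by positivity))
  have hlarge := (RUMnet.le_numSamples (ℓ := ℓ) hκ hM hε hε1 hδ hδ1).trans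
    (Nat.cast_le (α := ℝ).2 hK')
  have hn : 0 < K' := by
    have hlog : 0 < Real.log (1 / δ) := Real.log_pos (by rw [lt_div_iff₀ hδ]; linarith)
    have hpos : 0 < 1280 / ε ^ 2 * Real.log (1 / δ) * ((κ : ℝ) * Real.exp (2 * M)) ^ 2 := by
      positivity
    exact_mod_cast hpos.trans_le hlarge
  -- One level `τ` serves both claims: it is at most `3ε`, and multiplied by the swap factor `256 κ
  -- e^{2M}` it becomes `2ε`.
  have hτ : 0 ≤ ε / (128 * (κ * Real.exp (2 * M))) := by positivity
  have hmain := RUMnet.le_uniformOn_expectedKL_resample_le σ σout μ D N hn hK hκ hτ hD'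
    (RUMnet.exp_neg_le_of_le_numSamples hκ hM hε hε1 hδ hδ1 hlarge)
  refine ⟨hmain.trans (measure_mono fun s hs => ?_), ?_⟩
  · refine le_trans hs (ENNReal.ofReal_le_ofReal ?_)
    rw [div_le_iff₀ (by positivity)]
    nlinarith
  · rintro rfl hℓ hσ hσout
    refine hmain.trans (measure_mono fun s hs => ?_)
    refine (RUMnet.expectedKL_swap_le N (N.resample s) hK hn hM hℓ hσ hσout D hD').trans ?_
    refine le_trans (mul_le_mul_right hs _) ?_
    rw [← ENNReal.ofReal_mul (by positivity)]
    refine ENNReal.ofReal_le_ofReal ?_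
    have : 256 * (κ * Real.exp (2 * M)) * (ε / (128 * (κ * Real.exp (2 * M)))) = 2 * ε := by
      field_simp
      norm_num
    rw [this]
    linarith
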